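/- Let $n\ge 2$. A \emph{convex surface} in $\mathbb{R}^n$ is the boundary of an $n$-dimensional convex set distinct from $\mathbb{R}^n$. A \emph{real quadric surface} is a nonempty set of the form \[ \Big\{(x_1,\dots,x_n)\in\mathbb{R}^n : \sum_{i,k=1}^n a_{ik}x_ix_k+2\sum_{i=1}^n b_ix_i+c=0\Big\} \] with real coefficients, where the symmetric matrix $(a_{ik})$ is not zero. A convex surface $S\subset\mathbb{R}^n$ is called a \emph{convex quadric} if there are a real quadric surface $Q\subset\mathbb{R}^n$ and a convex connected component $U$ of $\mathbb{R}^n\setminus Q$ such that $S$ is the boundary of $U$. A convex surface $S\subset\mathbb{R}^n$ is a convex quadric if and only if there are Cartesian (orthonormal, with arbitrary origin) coordinates $\xi_1,\dots,\xi_n$ in which $S$ is given by one of the equations \begin{align*} & a_1\xi_1^2+\cdots+a_k\xi_k^2=1, && 1\le k\le n,\\ & a_1\xi_1^2-a_2\xi_2^2-\cdots-a_k\xi_k^2=1,\quad \xi_1\ge 0, && 2\le k\le n,\\ & a_1\xi_1^2=0,\\ & a_1\xi_1^2-a_2\xi_2^2-\cdots-a_k\xi_k^2=0,\quad \xi_1\ge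 0, && 2\le k\le n,\\ & a_1\xi_1^2+\cdots+a_{k-1}\xi_{k-1}^2=\xi_k, && 2\le k\le n, \end{align*} where all scalars $a_i$ involved are positive. -/

import Mathlib

/-- A real quadric surface in `ℝⁿ`: a nonempty locus
`∑ aᵢₖ ξᵢ ξₖ + 2 ∑ bᵢ ξᵢ + c = 0`, where the (symmetric) coefficient matrix `(aᵢₖ)` is not zero. -/
def IsRealQuadric {n : ℕ} (Q : Set (EuclideanSpace ℝ (Fin n))) : Prop :=
  Q.Nonempty ∧
    ∃ (A : Matrix (Fin n) (Fin n) ℝ) (b : Fin n → ℝ) (c : ℝ), A.IsSymm ∧ A ≠ 0 ∧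
      Q = {x | (∑ i, ∑ k, A i k * x i * x k) + 2 * (∑ i, b i * x i) + c = 0}

/-- A convex surface: the boundary of an `n`-dimensional convex set distinct from `ℝⁿ`. -/
def IsConvexSurface {n : ℕ} (S : Set (EuclideanSpace ℝ (Fin n))) : Prop :=
  ∃ K : Set (EuclideanSpace ℝ (Fin n)),
    Convex ℝ K ∧ affineSpan ℝ K = ⊤ ∧ K ≠ Set.univ ∧ S = frontier K

/-- A convex quadric: a convex surface which is the boundary of a convex connected component `U`
of the complement of a real quadric surface. -/
def IsConvexQuadric {n : ℕ} (S : Set (EuclideanSpace ℝ (Fin n))) : Prop :=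
  IsConvexSurface S ∧
    ∃ Q : Set (EuclideanSpace ℝ (Fin n)), IsRealQuadric Q ∧
      ∃ p ∈ Qᶜ, Convex ℝ (connectedComponentIn Qᶜ p) ∧ S = frontier (connectedComponentIn Qᶜ p)

/-!
The five canonical loci in coordinates `ξ`. Indices run over `Fin n`, so they start at `0`, and
`j` is the index of the last variable involved: `j = k - 1` in terms of the number `k` of variables.
-/

/-- `a₁ξ₁² + ⋯ + aₖξₖ² = 1`. -/
def ellipticLocus {n : ℕ} (a : Fin n → ℝ) (j : Fin n) : Set (EuclideanSpace ℝ (Fin n)) :=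
  {ξ | ∑ i ∈ Finset.Iic j, a i * ξ i ^ 2 = 1}

/-- `a₁ξ₁² - a₂ξ₂² - ⋯ - aₖξₖ² = 1`, `ξ₁ ≥ 0`. -/
def hyperbolicLocus {n : ℕ} [NeZero n] (a : Fin n → ℝ) (j : Fin n) :
    Set (EuclideanSpace ℝ (Fin n)) :=
  {ξ | a 0 * ξ 0 ^ 2 - ∑ i ∈ Finset.Ioc 0 j, a i * ξ i ^ 2 = 1 ∧ 0 ≤ ξ 0}

/-- `a₁ξ₁² = 0`. -/
def planeLocus {n : ℕ} [NeZero n] (a : Fin n → ℝ) : Set (EuclideanSpace ℝ (Fin n)) :=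
  {ξ | a 0 * ξ 0 ^ 2 = 0}

/-- `a₁ξ₁² - a₂ξ₂² - ⋯ - aₖξₖ² = 0`, `ξ₁ ≥ 0`. -/
def coneLocus {n : ℕ} [NeZero n] (a : Fin n → ℝ) (j : Fin n) : Set (EuclideanSpace ℝ (Fin n)) :=
  {ξ | a 0 * ξ 0 ^ 2 - ∑ i ∈ Finset.Ioc 0 j, a i * ξ i ^ 2 = 0 ∧ 0 ≤ ξ 0}

/-- `a₁ξ₁² + ⋯ + aₖ₋₁ξₖ₋₁² = ξₖ`. -/
def parabolicLocus {n : ℕ} (a : Fin n → ℝ) (j : Fin n) : Set (EuclideanSpace ℝ (Fin n)) :=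
  {ξ | ∑ i ∈ Finset.Iio j, a i * ξ i ^ 2 = ξ j}

/-- The set `T` of coordinate vectors is one of the five canonical loci, with all coefficients
that occur in its equation positive. -/
def IsCanonicalLocus {n : ℕ} [NeZero n] (T : Set (EuclideanSpace ℝ (Fin n))) : Prop :=
  ∃ a : Fin n → ℝ,
    (∃ j : Fin n, (∀ i ≤ j, 0 < a i) ∧ T = ellipticLocus a j) ∨
    (∃ j : Fin n, 0 < j ∧ (∀ i ≤ j, 0 < a i) ∧ T = hyperbolicLocus a j) ∨
    (0 < a 0 ∧ T = planeLocus a) ∨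
    (∃ j : Fin n, 0 < j ∧ (∀ i ≤ j, 0 < a i) ∧ T = coneLocus a j) ∨
    (∃ j : Fin n, 0 < j ∧ (∀ i < j, 0 < a i) ∧ T = parabolicLocus a j)

/-!
Diagonalising the quadratic part, completing the square and moving the remaining linear part onto
one coordinate axis in the kernel (by a reflection) brings a quadric to the form
`∑ lamᵢ xᵢ² + β xₘ + c = 0`, where `β ≠ 0` forces `lamₘ = 0` and `c = 0`. Up to a sign the given
component `V` lies where this polynomial is positive.

If no `lamᵢ` is positive, the polynomial is concave, so `V` is the whole region where it is positive
and its boundary is an elliptic or a parabolic locus. If some `lamₖ > 0`, the quadric is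
`xₖ² = r(x)` with `r` independent of `xₖ`. A point of `V` with `r < 0` would put a whole line
parallel to the `k`-th axis into the convex set `V`; the boundary of `V` would then be invariant
under translation along this axis, which is impossible on `xₖ² = r(x)`. Hence `r ≥ 0` everywhere, so
`r` is a nonnegative diagonal form plus a nonnegative constant, and `V` is one of the convex sets
`±xₖ > √r`.
-/

open Set Filter Topology

section Components

variable {X : Type*} [TopologicalSpace X]

theorem subset_of_isPreconnected_of_disjoint_frontier {C V : Set X} (hC : IsPreconnected C)
    (hV : IsOpen V) (hCV : (C ∩ V).Nonempty) (hd : Disjoint C (frontier V)) : C ⊆ V := by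
  refine hC.subset_of_closure_inter_subset hV hCV fun x ⟨hxV, hxC⟩ => ?_
  by_contra hx
  exact hd.notMem_of_mem_left hxC (hV.frontier_eq ▸ ⟨hxV, hx⟩)

theorem connectedComponentIn_compl_eq_of_frontier_subset {U Q : Set X} {p : X} (hU : IsOpen U)
    (hUc : IsPreconnected U) (hp : p ∈ U) (hUQ : U ⊆ Qᶜ) (hf : frontier U ⊆ Q) :
    connectedComponentIn Qᶜ p = U := by
  refine Subset.antisymm ?_ (hUc.subset_connectedComponentIn hp hUQ)
  refine subset_of_isPreconnected_of_disjoint_frontier isPreconnected_connectedComponentIn hU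
    ⟨p, mem_connectedComponentIn (hUQ hp), hp⟩ (disjoint_left.2 fun x hx hxU => ?_)
  exact connectedComponentIn_subset _ _ hx (hf hxU)

theorem frontier_connectedComponentIn_compl_subset [LocallyConnectedSpace X] {Q : Set X}
    (hQ : IsClosed Q) (p : X) : frontier (connectedComponentIn Qᶜ p) ⊆ Q := by
  rw [(hQ.isOpen_compl.connectedComponentIn (x := p)).frontier_eq]
  rintro x ⟨hx, hxp⟩
  by_contra hxQ
  obtain ⟨y, hyx, hyp⟩ := mem_closure_iff.1 hx _
    (hQ.isOpen_compl.connectedComponentIn (x := x)) (mem_connectedComponentIn hxQ)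
  refine hxp ?_
  rw [connectedComponentIn_eq hyp, ← connectedComponentIn_eq hyx]
  exact mem_connectedComponentIn hxQ

theorem frontier_connectedComponentIn_nonempty [PreconnectedSpace X] {F : Set X} {p : X}
    (hp : p ∈ F) (hF : F ≠ univ) : (frontier (connectedComponentIn F p)).Nonempty :=
  nonempty_frontier_iff.2 ⟨⟨p, mem_connectedComponentIn hp⟩,
    fun h => hF (univ_subset_iff.1 (h ▸ connectedComponentIn_subset F p))⟩

theorem image_connectedComponentIn_compl {Y : Type*} [TopologicalSpace Y] (h : X ≃ₜ Y) {F : Set X}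
    {x : X} (hx : x ∈ Fᶜ) :
    h '' connectedComponentIn Fᶜ x = connectedComponentIn (h '' F)ᶜ (h x) := by
  rw [h.image_connectedComponentIn hx, image_compl_eq h.bijective]

end Components

section Convexity

variable {E : Type*} [AddCommGroup E] [Module ℝ E] [TopologicalSpace E] [IsTopologicalAddGroup E]
  [ContinuousSMul ℝ E]

theorem frontier_setOf_lt_of_convexOn_of_concaveOn {f g : E → ℝ} (hf : ConvexOn ℝ univ f)
    (hg : ConcaveOn ℝ univ g) (hfc : Continuous f) (hgc : Continuous g) {p : E} (hp : f p < g p) :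
    frontier {x | f x < g x} = {x | f x = g x} := by
  refine (frontier_lt_subset_eq hfc hgc).antisymm fun x (hx : f x = g x) => ?_
  rw [(isOpen_lt hfc hgc).frontier_eq]
  refine ⟨?_, hx.not_lt⟩
  have hsub : openSegment ℝ p x ⊆ {x | f x < g x} := by
    rintro _ ⟨s, t, hs, ht, hst, rfl⟩
    calc f (s • p + t • x) ≤ s • f p + t • f x :=
          hf.2 (mem_univ p) (mem_univ x) hs.le ht.le hst
      _ < s • g p + t • g x := by
          rw [hx]
          gcongr
      _ ≤ g (s • p + t • x) := hg.2 (mem_univ p) (mem_univ x) hs.le ht.le hst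
  exact closure_mono hsub (segment_subset_closure_openSegment (right_mem_segment ℝ p x))

theorem connectedComponentIn_compl_eq_setOf_lt {f g : E → ℝ} (hf : ConvexOn ℝ univ f)
    (hg : ConcaveOn ℝ univ g) (hfc : Continuous f) (hgc : Continuous g) {p : E} (hp : f p < g p)
    {Q : Set E} (heq : ∀ x, f x = g x → x ∈ Q) (hlt : ∀ x, f x < g x → x ∉ Q) :
    connectedComponentIn Qᶜ p = {x | f x < g x} := by
  have hconv : Convex ℝ {x | f x < g x} := by simpa using (hf.sub hg).convex_lt 0
  exact connectedComponentIn_compl_eq_of_frontier_subset (isOpen_lt hfc hgc) hconv.isPreconnected hp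
    hlt ((frontier_lt_subset_eq hfc hgc).trans heq)

theorem add_smul_mem_closure_of_line_subset {V : Set E} (hV : Convex ℝ V) {p d w : E}
    (hline : ∀ t : ℝ, p + t • d ∈ V) (hw : w ∈ closure V) (t : ℝ) : w + t • d ∈ closure V := by
  have hlim : Tendsto (fun s : ℝ => (1 - s) • w + s • p + t • d) (𝓝[>] 0) (𝓝 (w + t • d)) := by
    have hc : Continuous fun s : ℝ => (1 - s) • w + s • p + t • d := by fun_prop
    simpa using (hc.tendsto 0).mono_left nhdsWithin_le_nhds
  refine isClosed_closure.mem_of_tendsto hlim ?_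
  filter_upwards [Ioo_mem_nhdsGT one_pos] with s ⟨hs0, hs1⟩
  have h := hV.closure hw (subset_closure (hline (t / s))) (sub_nonneg.2 hs1.le) hs0.le (by ring)
  rwa [smul_add, smul_smul, mul_div_cancel₀ _ hs0.ne', ← add_assoc] at h

theorem add_smul_mem_frontier_of_line_subset {V : Set E} (hV : Convex ℝ V) {p d w : E}
    (hline : ∀ t : ℝ, p + t • d ∈ V) (hw : w ∈ frontier V) (t : ℝ) : w + t • d ∈ frontier V := by
  have hcl := add_smul_mem_closure_of_line_subset hV hline hw.1
  refine ⟨hcl t, fun h => hw.2 ?_⟩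
  have hmid := hV.combo_interior_closure_mem_interior h (hcl (-t)) (a := 1 / 2) (b := 1 / 2)
    (by norm_num) (by norm_num) (by norm_num)
  convert hmid using 1
  module

end Convexity

section TwoSheets

variable {E : Type*} [AddCommGroup E] [Module ℝ E] [TopologicalSpace E] [IsTopologicalAddGroup E]
  [ContinuousSMul ℝ E] {ℓ : E →L[ℝ] ℝ} {r : E → ℝ} {d p : E}

theorem isPreconnected_setOf_sqrt_lt (hr : Continuous r) (hd : ℓ d = 1)
    (hrd : ∀ x (t : ℝ), r (x + t • d) = r x) : IsPreconnected {x | √(r x) < ℓ x} := by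
  have himage : {x | √(r x) < ℓ x} =
      (fun y : E × ℝ => y.1 + (√(r y.1) - ℓ y.1 + y.2) • d) '' (univ ×ˢ Ioi 0) := by
    ext x
    constructor
    · intro hx
      exact ⟨(x, ℓ x - √(r x)), ⟨mem_univ x, mem_Ioi.2 (sub_pos.2 hx)⟩, by simp⟩
    · rintro ⟨⟨y, s⟩, ⟨-, hs : 0 < s⟩, rfl⟩
      simp only [mem_ofPred_eq, hrd, map_add, map_smul, hd, smul_eq_mul, mul_one]
      linarith
  rw [himage]
  refine (convex_univ.isPreconnected.prod isPreconnected_Ioi).image _ (Continuous.continuousOn ?_)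
  fun_prop

variable [LocallyConnectedSpace E]

/- If `r x < 0`, the line `x + ℝd` misses the locus, hence lies in the component, whose frontier is
then invariant under translations along `d`; but `ℓ ^ 2 = r` cannot hold on a whole such line. -/
theorem nonneg_of_mem_connectedComponentIn (hr : Continuous r) (hd : ℓ d = 1)
    (hrd : ∀ x (t : ℝ), r (x + t • d) = r x) (hQ : {x | ℓ x ^ 2 = r x}.Nonempty)
    (hV : Convex ℝ (connectedComponentIn {x | ℓ x ^ 2 = r x}ᶜ p)) {x : E}
    (hx : x ∈ connectedComponentIn {x | ℓ x ^ 2 = r x}ᶜ p) : 0 ≤ r x := by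
  by_contra! hneg
  have := IsTopologicalAddGroup.pathConnectedSpace (E := E)
  have hline : ∀ t : ℝ, x + t • d ∈ connectedComponentIn {x | ℓ x ^ 2 = r x}ᶜ p := by
    have hpre : IsPreconnected (range fun t : ℝ => x + t • d) :=
      isPreconnected_range (by fun_prop)
    rw [connectedComponentIn_eq hx]
    refine range_subset_iff.1 (hpre.subset_connectedComponentIn ⟨0, by simp⟩ ?_)
    rintro _ ⟨t, rfl⟩
    exact fun h : ℓ (x + t • d) ^ 2 = r (x + t • d) =>
      (hrd x t ▸ hneg).not_ge (h ▸ sq_nonneg _)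
  obtain ⟨w, hw⟩ := frontier_connectedComponentIn_nonempty
    (connectedComponentIn_nonempty_iff.1 ⟨x, hx⟩) (compl_ne_univ.2 hQ)
  have hwline : ∀ t : ℝ, (ℓ w + t) ^ 2 = r w := fun t => by
    have h : ℓ (w + t • d) ^ 2 = r (w + t • d) :=
      frontier_connectedComponentIn_compl_subset (isClosed_eq (by fun_prop) hr) p
        (add_smul_mem_frontier_of_line_subset hV hline hw t)
    simpa [hrd, hd] using h
  linarith [hwline (-ℓ w), hwline (1 - ℓ w)]

theorem connectedComponentIn_eq_setOf_sqrt_lt (hr : Continuous r) (hd : ℓ d = 1)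
    (hrd : ∀ x (t : ℝ), r (x + t • d) = r x) (hQ : {x | ℓ x ^ 2 = r x}.Nonempty)
    (hV : Convex ℝ (connectedComponentIn {x | ℓ x ^ 2 = r x}ᶜ p)) (hp : √(r p) < ℓ p) :
    (∀ x, 0 ≤ r x) ∧
      connectedComponentIn {x | ℓ x ^ 2 = r x}ᶜ p = {x | √(r x) < ℓ x} := by
  have hpre := isPreconnected_setOf_sqrt_lt hr hd hrd
  have hsub : {x | √(r x) < ℓ x} ⊆ {x | ℓ x ^ 2 = r x}ᶜ := fun x hx =>
    ((Real.sqrt_lt' ((Real.sqrt_nonneg _).trans_lt hx)).1 hx).ne'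
  have hnonneg : ∀ x, 0 ≤ r x := by
    intro x
    have hmem : x + (√(r x) - ℓ x + 1) • d ∈ {x | √(r x) < ℓ x} := by
      simp only [mem_ofPred_eq, hrd, map_add, map_smul, hd, smul_eq_mul, mul_one]
      linarith
    have h := nonneg_of_mem_connectedComponentIn hr hd hrd hQ hV
      (hpre.subset_connectedComponentIn hp hsub hmem)
    rwa [hrd] at h
  refine ⟨hnonneg, connectedComponentIn_compl_eq_of_frontier_subset
    (isOpen_lt (by fun_prop) (by fun_prop)) hpre hp hsub ?_⟩
  refine (frontier_lt_subset_eq (by fun_prop) (by fun_prop)).trans fun x (hx : √(r x) = ℓ x) => ?_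
  rw [mem_ofPred_eq, ← hx, Real.sq_sqrt (hnonneg x)]

theorem connectedComponentIn_eq_sheet (hr : Continuous r) (hd : ℓ d = 1)
    (hrd : ∀ x (t : ℝ), r (x + t • d) = r x) (hQ : {x | ℓ x ^ 2 = r x}.Nonempty)
    (hV : Convex ℝ (connectedComponentIn {x | ℓ x ^ 2 = r x}ᶜ p)) (hp : r p < ℓ p ^ 2) :
    (∀ x, 0 ≤ r x) ∧
      (connectedComponentIn {x | ℓ x ^ 2 = r x}ᶜ p = {x | √(r x) < ℓ x} ∨
        connectedComponentIn {x | ℓ x ^ 2 = r x}ᶜ p = {x | √(r x) < -ℓ x}) := by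
  have hrp : 0 ≤ r p :=
    nonneg_of_mem_connectedComponentIn hr hd hrd hQ hV (mem_connectedComponentIn hp.ne')
  have hlt : √(r p) < |ℓ p| := by rwa [Real.sqrt_lt hrp (abs_nonneg _), sq_abs]
  rcases abs_cases (ℓ p) with ⟨habs, -⟩ | ⟨habs, -⟩ <;> rw [habs] at hlt
  · exact (connectedComponentIn_eq_setOf_sqrt_lt hr hd hrd hQ hV hlt).imp_right Or.inl
  · have hneg : {x | (-ℓ) x ^ 2 = r x} = {x | ℓ x ^ 2 = r x} := by simp
    rw [← hneg] at hQ hV ⊢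
    refine (connectedComponentIn_eq_setOf_sqrt_lt hr (d := -d) (by simpa using hd) (fun x t => ?_)
      hQ hV hlt).imp_right Or.inr
    rw [smul_neg, ← neg_smul, hrd]

end TwoSheets

/-- The diagonal quadratic form `∑ lamᵢ xᵢ²` with coefficients `lam`. -/
def diagForm {ι : Type*} [Fintype ι] (lam : ι → ℝ) (x : EuclideanSpace ℝ ι) : ℝ :=
  ∑ i, lam i * x i ^ 2

section DiagForm

variable {ι : Type*} [Fintype ι] {lam : ι → ℝ}

theorem continuous_diagForm (lam : ι → ℝ) : Continuous (diagForm lam) := by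
  unfold diagForm
  fun_prop

theorem diagForm_nonneg (hlam : 0 ≤ lam) (x : EuclideanSpace ℝ ι) : 0 ≤ diagForm lam x :=
  Finset.sum_nonneg fun i _ => mul_nonneg (hlam i) (sq_nonneg _)

theorem diagForm_smul (s : ℝ) (lam : ι → ℝ) (x : EuclideanSpace ℝ ι) :
    diagForm (s • lam) x = s * diagForm lam x := by
  simp only [diagForm, Finset.mul_sum, Pi.smul_apply, smul_eq_mul, mul_assoc]

theorem diagForm_neg (lam : ι → ℝ) (x : EuclideanSpace ℝ ι) :
    diagForm (-lam) x = -diagForm lam x := by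
  simp only [diagForm, Pi.neg_apply, neg_mul, Finset.sum_neg_distrib]

theorem diagForm_eq_sum {J : Finset ι} (hJ : ∀ i, i ∈ J ↔ lam i ≠ 0) (x : EuclideanSpace ℝ ι) :
    diagForm lam x = ∑ i ∈ J, lam i * x i ^ 2 :=
  (Finset.sum_subset J.subset_univ fun i _ hi => by simp [not_not.1 (mt (hJ i).2 hi)]).symm

theorem diagForm_indicator (J : Finset ι) (a : ι → ℝ) (x : EuclideanSpace ℝ ι) :
    diagForm ((J : Set ι).indicator a) x = ∑ i ∈ J, a i * x i ^ 2 := by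
  classical
  simp [diagForm, indicator_apply, ite_mul, Finset.sum_ite_mem]

theorem diagForm_comp_perm (lam : ι → ℝ) (σ : Equiv.Perm ι) (x : EuclideanSpace ℝ ι) :
    diagForm lam (WithLp.toLp 2 fun i => x (σ i)) = diagForm (lam ∘ σ.symm) x :=
  Fintype.sum_equiv σ _ _ fun i => by simp

theorem diagForm_single [DecidableEq ι] (lam : ι → ℝ) (i : ι) (t : ℝ) :
    diagForm lam (EuclideanSpace.single i t) = lam i * t ^ 2 := by
  simp [diagForm, PiLp.single_apply, ite_pow]

theorem diagForm_update [DecidableEq ι] (lam : ι → ℝ) (k : ι) (s : ℝ) (x : EuclideanSpace ℝ ι) :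
    diagForm (Function.update lam k s) x = diagForm lam x + (s - lam k) * x k ^ 2 := by
  simp only [diagForm, ← Finset.add_sum_erase _ _ (Finset.mem_univ k), Function.update_self]
  rw [Finset.sum_congr rfl fun i hi => by rw [Function.update_of_ne (Finset.ne_of_mem_erase hi)]]
  ring

theorem diagForm_eq_mul_sq_sub [DecidableEq ι] {k : ι} (hk : lam k ≠ 0)
    (x : EuclideanSpace ℝ ι) : diagForm lam x =
      lam k * (x k ^ 2 - diagForm (Function.update (-(lam k)⁻¹ • lam) k 0) x) := by
  simp only [diagForm_update, diagForm_smul, Pi.smul_apply, smul_eq_mul]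
  field

theorem diagForm_add_smul_single [DecidableEq ι] {k : ι} (hk : lam k = 0)
    (x : EuclideanSpace ℝ ι) (t : ℝ) :
    diagForm lam (x + t • EuclideanSpace.single k 1) = diagForm lam x := by
  refine Finset.sum_congr rfl fun i _ => ?_
  by_cases hi : i = k
  · simp [hi, hk]
  · simp [hi]

/- The function is the Euclidean norm of the vector with coordinates `√lamᵢ xᵢ` and `√d`, which
depends affinely on `x`. -/
theorem convexOn_sqrt_diagForm_add (hlam : 0 ≤ lam) {d : ℝ} (hd : 0 ≤ d) :
    ConvexOn ℝ univ fun x => √(diagForm lam x + d) := by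
  let f : EuclideanSpace ℝ ι → EuclideanSpace ℝ (Option ι) := fun x =>
    WithLp.toLp 2 fun o => o.elim √d fun i => √(lam i) * x i
  have hf : ∀ x, √(diagForm lam x + d) = ‖f x‖ := fun x => by
    simp only [f, EuclideanSpace.norm_eq, Fintype.sum_option, Option.elim, Real.norm_eq_abs,
      sq_abs, mul_pow, Real.sq_sqrt hd, Real.sq_sqrt (hlam _), diagForm, add_comm d]
  refine ⟨convex_univ, fun x _ y _ s t hs ht hst => ?_⟩
  have hcombo : f (s • x + t • y) = s • f x + t • f y := by
    ext (_ | i)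
    · simp [f, ← add_mul, hst]
    · simp [f]
      ring
  simp only [hf, hcombo]
  exact convexOn_univ_norm.2 (mem_univ _) (mem_univ _) hs ht hst

theorem convexOn_diagForm (hlam : 0 ≤ lam) : ConvexOn ℝ univ (diagForm lam) := by
  have hsq : (fun x => √(diagForm lam x + 0)) ^ 2 = diagForm lam :=
    funext fun x => by simp [Real.sq_sqrt (diagForm_nonneg hlam x)]
  exact hsq ▸ (convexOn_sqrt_diagForm_add hlam le_rfl).pow (fun _ _ => Real.sqrt_nonneg _) 2

theorem concaveOn_coord_mul_add {ι : Type*} (m : ι) (β c : ℝ) :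
    ConcaveOn ℝ univ fun x : EuclideanSpace ℝ ι => β * x m + c :=
  ((β • EuclideanSpace.projₗ m : EuclideanSpace ℝ ι →ₗ[ℝ] ℝ).concaveOn convex_univ).add_const c

theorem setOf_sub_diagForm_eq_eq_setOf_sqrt {α d : ℝ} (k : ι) (hα : 0 < α) (hlam : 0 ≤ lam)
    (hd : 0 ≤ d) : {x | α * x k ^ 2 - diagForm lam x = d ∧ 0 ≤ x k} =
      {x | √(diagForm (α⁻¹ • lam) x + α⁻¹ * d) = x k} := by
  ext x
  have hform : diagForm (α⁻¹ • lam) x + α⁻¹ * d = (diagForm lam x + d) / α := by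
    rw [diagForm_smul]
    field
  have hnonneg : 0 ≤ (diagForm lam x + d) / α :=
    div_nonneg (add_nonneg (diagForm_nonneg hlam x) hd) hα.le
  rw [mem_ofPred_eq, mem_ofPred_eq, hform]
  constructor
  · rintro ⟨h, hx⟩
    rw [Real.sqrt_eq_iff_eq_sq hnonneg hx, div_eq_iff hα.ne']
    linarith
  · intro h
    refine ⟨?_, h ▸ Real.sqrt_nonneg _⟩
    rw [← h, Real.sq_sqrt hnonneg, mul_div_cancel₀ _ hα.ne', add_sub_cancel_left]

theorem nonneg_of_forall_diagForm_add_nonneg {m : ι} {β c : ℝ} (hm : β ≠ 0 → lam m = 0)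
    (h : ∀ x, 0 ≤ diagForm lam x + β * x m + c) : 0 ≤ lam ∧ β = 0 ∧ 0 ≤ c := by
  classical
  have hc : 0 ≤ c := by simpa [diagForm] using h 0
  have hβ : β = 0 := by
    by_contra hβ
    have h' := h (EuclideanSpace.single m (-(c + 1) / β))
    rw [diagForm_single, hm hβ, PiLp.single_eq_same, mul_div_cancel₀ _ hβ] at h'
    linarith
  refine ⟨fun i => ?_, hβ, hc⟩
  have hdiscrim : discrim (lam i) 0 (c + 1) ≤ 0 := discrim_le_zero fun t => by
    have h' := h (EuclideanSpace.single i t)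
    rw [diagForm_single, hβ] at h'
    linarith
  rw [discrim] at hdiscrim
  rw [Pi.zero_apply]
  nlinarith

end DiagForm

open scoped RealInnerProductSpace

section QuadPoly

variable {E : Type*} [NormedAddCommGroup E] [InnerProductSpace ℝ E] {T : E →ₗ[ℝ] E}

/-- The quadratic polynomial `⟪T x, x⟫ + 2 ⟪b, x⟫ + c`, a real quadric in coordinate-free form. -/
def quadPoly (T : E →ₗ[ℝ] E) (b : E) (c : ℝ) (x : E) : ℝ :=
  ⟪T x, x⟫ + 2 * ⟪b, x⟫ + c

theorem quadPoly_neg (T : E →ₗ[ℝ] E) (b : E) (c : ℝ) (x : E) :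
    quadPoly (-T) (-b) (-c) x = -quadPoly T b c x := by
  simp only [quadPoly, LinearMap.neg_apply, inner_neg_left]
  ring

theorem quadPoly_add (hT : T.IsSymmetric) (b : E) (c : ℝ) (x v : E) :
    quadPoly T b c (x + v) = quadPoly T (T v + b) (quadPoly T b c v) x := by
  have hsymm : ⟪T x, v⟫ = ⟪T v, x⟫ := by rw [hT x v, real_inner_comm]
  simp only [quadPoly, map_add, inner_add_left, inner_add_right, hsymm]
  ring

theorem exists_quadPoly_comp_eq {F : Type*} [NormedAddCommGroup F] [InnerProductSpace ℝ F]
    (hT : T.IsSymmetric) (hT0 : T ≠ 0) (b : E) (c : ℝ) (e : F ≃ᵃⁱ[ℝ] E) :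
    ∃ (T' : F →ₗ[ℝ] F) (b' : F) (c' : ℝ), T'.IsSymmetric ∧ T' ≠ 0 ∧
      ∀ x, quadPoly T b c (e x) = quadPoly T' b' c' x := by
  let L := e.linearIsometryEquiv
  refine ⟨L.symm.toLinearEquiv.conj T, L.symm (T (e 0) + b), quadPoly T b c (e 0), ?_, ?_, ?_⟩
  · intro x y
    simp [LinearEquiv.conj_apply, ← L.inner_map_map, hT (L x)]
  · simpa using hT0
  · intro x
    have hx : e x = L x + e 0 := by simpa using e.map_vadd 0 x
    rw [hx, quadPoly_add hT]
    simp [quadPoly, LinearEquiv.conj_apply, ← L.inner_map_map]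

theorem exists_eq_apply_add_of_isSymmetric [FiniteDimensional ℝ E] (hT : T.IsSymmetric) (b : E) :
    ∃ u b₀, T b₀ = 0 ∧ b = T u + b₀ := by
  obtain ⟨_, ⟨u, rfl⟩, b₀, hb₀, rfl⟩ := T.range.exists_add_mem_mem_orthogonal b
  rw [hT.orthogonal_range] at hb₀
  exact ⟨u, b₀, hb₀, rfl⟩

theorem exists_quadPoly_eq_translate [FiniteDimensional ℝ E] (hT : T.IsSymmetric) (b : E) (c : ℝ) :
    ∃ (v b₀ : E) (c₀ : ℝ), T b₀ = 0 ∧ (b₀ ≠ 0 → c₀ = 0) ∧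
      ∀ x, quadPoly T b c x = quadPoly T b₀ c₀ (x + v) := by
  obtain ⟨u, b₀, hb₀, rfl⟩ := exists_eq_apply_add_of_isSymmetric hT b
  rcases eq_or_ne b₀ 0 with rfl | hne
  · refine ⟨u, 0, c - ⟪T u, u⟫, hb₀, fun h => absurd rfl h, fun x => ?_⟩
    rw [quadPoly_add hT]
    simp [quadPoly]
  · let s := (c - ⟪T u, u⟫ - 2 * ⟪b₀, u⟫) / (2 * ‖b₀‖ ^ 2)
    have hs : s * (2 * ‖b₀‖ ^ 2) = c - ⟪T u, u⟫ - 2 * ⟪b₀, u⟫ := div_mul_cancel₀ _ (by simpa)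
    have horth : ⟪T u, b₀⟫ = 0 := by rw [hT, hb₀, inner_zero_right]
    have hc : quadPoly T b₀ 0 (u + s • b₀) = c := by
      simp only [quadPoly, map_add, map_smul, hb₀, inner_add_right, inner_smul_right, horth,
        real_inner_self_eq_norm_sq, smul_zero, add_zero, mul_zero]
      linarith
    refine ⟨u + s • b₀, b₀, 0, hb₀, fun _ => rfl, fun x => ?_⟩
    rw [quadPoly_add hT, hc, map_add, map_smul, hb₀, smul_zero, add_zero]

theorem apply_reflection_orthogonal_singleton (hT : T.IsSymmetric) {u : E} (hu : T u = 0) (x : E) :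
    T ((ℝ ∙ u)ᗮ.reflection x) = (ℝ ∙ u)ᗮ.reflection (T x) := by
  have horth : ⟪u, T x⟫ = 0 := by rw [← hT, hu, inner_zero_left]
  simp [Submodule.reflection_orthogonal, Submodule.reflection_singleton_apply, hu, horth]

theorem exists_orthonormalBasis_eigenvectors [FiniteDimensional ℝ E] {n : ℕ} [NeZero n]
    (hn : Module.finrank ℝ E = n) (hT : T.IsSymmetric) {b : E} (hb : T b = 0) :
    ∃ (w : OrthonormalBasis (Fin n) ℝ E) (lam : Fin n → ℝ) (m : Fin n),
      (∀ i, T (w i) = lam i • w i) ∧ b = ‖b‖ • w m ∧ (b ≠ 0 → lam m = 0) := by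
  let v := hT.eigenvectorBasis hn
  let lam := hT.eigenvalues hn
  have hv : ∀ i, T (v i) = lam i • v i := hT.apply_eigenvectorBasis hn
  rcases eq_or_ne b 0 with rfl | hb0
  · exact ⟨v, lam, 0, hv, by simp, fun h => absurd rfl h⟩
  obtain ⟨m, hm⟩ : ∃ m, ⟪v m, b⟫ ≠ 0 := by
    by_contra! h
    exact hb0 (v.repr.map_eq_zero_iff.1 (by ext i; simpa [v.repr_apply_apply] using h i))
  have hlam : lam m = 0 := by
    have h : lam m * ⟪v m, b⟫ = 0 := by
      rw [← real_inner_smul_left, ← hv, hT, hb, inner_zero_right]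
    exact (mul_eq_zero.1 h).resolve_right hm
  let f := ‖b‖⁻¹ • b
  have hker : T (v m - f) = 0 := by simp [f, hv, hlam, hb]
  let R := (ℝ ∙ (v m - f))ᗮ.reflection
  have hR : R (v m) = f := Submodule.reflection_sub (by simp [f, norm_smul, hb0])
  refine ⟨v.map R, lam, m, fun i => ?_, ?_, fun _ => hlam⟩
  · rw [OrthonormalBasis.map_apply, apply_reflection_orthogonal_singleton hT hker, hv, map_smul]
  · rw [OrthonormalBasis.map_apply, hR, smul_inv_smul₀ (norm_ne_zero_iff.2 hb0)]

theorem inner_apply_self_eq_diagForm {ι : Type*} [Fintype ι] {w : OrthonormalBasis ι ℝ E}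
    {lam : ι → ℝ} (hT : T.IsSymmetric) (hw : ∀ i, T (w i) = lam i • w i) (x : E) :
    ⟪T x, x⟫ = diagForm lam (w.repr x) := by
  rw [← w.sum_inner_mul_inner]
  refine Finset.sum_congr rfl fun i _ => ?_
  rw [hT, hw, inner_smul_right, real_inner_comm, w.repr_apply_apply]
  ring

theorem exists_quadPoly_eq_diagForm [FiniteDimensional ℝ E] {n : ℕ} [NeZero n]
    (hn : Module.finrank ℝ E = n) (hT : T.IsSymmetric) (hT0 : T ≠ 0) (b : E) (c : ℝ) :
    ∃ (e : E ≃ᵃⁱ[ℝ] EuclideanSpace ℝ (Fin n)) (lam : Fin n → ℝ) (m : Fin n) (β c₀ : ℝ),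
      lam ≠ 0 ∧ 0 ≤ β ∧ (β ≠ 0 → lam m = 0 ∧ c₀ = 0) ∧
        ∀ x, quadPoly T b c x = diagForm lam (e x) + β * e x m + c₀ := by
  obtain ⟨v, b₀, c₀, hb₀, hc₀, hq⟩ := exists_quadPoly_eq_translate hT b c
  obtain ⟨w, lam, m, hw, hb, hm⟩ := exists_orthonormalBasis_eigenvectors hn hT hb₀
  refine ⟨(AffineIsometryEquiv.constVAdd ℝ E v).trans w.repr.toAffineIsometryEquiv, lam, m,
    2 * ‖b₀‖, c₀, ?_, by positivity, fun h => ?_, fun x => ?_⟩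
  · rintro rfl
    exact hT0 (w.toBasis.ext fun i => by simp [hw])
  · have hb₀0 : b₀ ≠ 0 := by simpa using h
    exact ⟨hm hb₀0, hc₀ hb₀0⟩
  · have hlin : ⟪b₀, x + v⟫ = ‖b₀‖ * w.repr (x + v) m := by
      rw [w.repr_apply_apply, ← real_inner_smul_left, ← hb]
    rw [hq, quadPoly, inner_apply_self_eq_diagForm hT hw, hlin]
    simp [add_comm x, mul_assoc]

end QuadPoly

section RealQuadric

variable {n : ℕ} {Q S : Set (EuclideanSpace ℝ (Fin n))}

theorem quadPoly_toEuclideanLin (A : Matrix (Fin n) (Fin n) ℝ) (b x : EuclideanSpace ℝ (Fin n))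
    (c : ℝ) : quadPoly (Matrix.toEuclideanLin A) b c x =
      (∑ i, ∑ k, A i k * x i * x k) + 2 * (∑ i, b i * x i) + c := by
  simp [quadPoly, PiLp.inner_apply, Matrix.mulVec, dotProduct, Finset.mul_sum, mul_comm,
    mul_left_comm, mul_assoc]

theorem isRealQuadric_iff_quadPoly : IsRealQuadric Q ↔ Q.Nonempty ∧
    ∃ (T : EuclideanSpace ℝ (Fin n) →ₗ[ℝ] EuclideanSpace ℝ (Fin n)) (b : EuclideanSpace ℝ (Fin n))
      (c : ℝ), T.IsSymmetric ∧ T ≠ 0 ∧ Q = {x | quadPoly T b c x = 0} := by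
  have hsymm (A : Matrix (Fin n) (Fin n) ℝ) :
      (Matrix.toEuclideanLin A).IsSymmetric ↔ A.IsSymm := by
    rw [Matrix.isSymmetric_toEuclideanLin_iff, Matrix.IsHermitian,
      Matrix.conjTranspose_eq_transpose_of_trivial, Matrix.IsSymm]
  refine and_congr_right fun _ => ⟨?_, ?_⟩
  · rintro ⟨A, b, c, hA, hA0, rfl⟩
    exact ⟨Matrix.toEuclideanLin A, WithLp.toLp 2 b, c, (hsymm A).2 hA, by simpa using hA0,
      by simp only [quadPoly_toEuclideanLin]⟩
  · rintro ⟨T, b, c, hT, hT0, rfl⟩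
    obtain ⟨A, rfl⟩ := (Matrix.toEuclideanLin (𝕜 := ℝ)).surjective T
    exact ⟨A, b, c, (hsymm A).1 hT, by simpa using hT0, by simp only [quadPoly_toEuclideanLin]⟩

theorem IsRealQuadric.exists_quadPoly_pos (hQ : IsRealQuadric Q)
    {p : EuclideanSpace ℝ (Fin n)} (hp : p ∈ Qᶜ) :
    ∃ (T : EuclideanSpace ℝ (Fin n) →ₗ[ℝ] EuclideanSpace ℝ (Fin n)) (b : EuclideanSpace ℝ (Fin n))
      (c : ℝ), T.IsSymmetric ∧ T ≠ 0 ∧ 0 < quadPoly T b c p ∧ Q = {x | quadPoly T b c x = 0} := by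
  obtain ⟨-, T, b, c, hT, hT0, rfl⟩ := isRealQuadric_iff_quadPoly.1 hQ
  rcases lt_or_gt_of_ne hp with hneg | hpos
  · refine ⟨-T, -b, -c, fun x y => by simp [hT x y], neg_ne_zero.2 hT0, ?_, ?_⟩
    · rw [quadPoly_neg]
      exact neg_pos.2 hneg
    · simp only [quadPoly_neg, neg_eq_zero]
  · exact ⟨T, b, c, hT, hT0, hpos, rfl⟩

theorem isRealQuadric_diagForm {lam : Fin n → ℝ} {m : Fin n} {β c : ℝ} (hlam : lam ≠ 0)
    (hQ : {x | diagForm lam x + β * x m + c = 0}.Nonempty) :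
    IsRealQuadric {x | diagForm lam x + β * x m + c = 0} := by
  refine ⟨hQ, Matrix.diagonal lam, Pi.single m (β / 2), c, Matrix.isSymm_diagonal lam,
    by simpa using hlam, ?_⟩
  ext x
  have hquad : ∑ i, ∑ k, Matrix.diagonal lam i k * x i * x k = diagForm lam x := by
    simp [diagForm, Matrix.diagonal_apply, ite_mul, mul_assoc, sq]
  have hlin : 2 * ∑ i, (Pi.single m (β / 2) : Fin n → ℝ) i * x i = β * x m := by
    simp [Pi.single_apply, ite_mul]
    ring
  rw [mem_ofPred_eq, mem_ofPred_eq, hquad, hlin]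

theorem IsRealQuadric.isClosed (hQ : IsRealQuadric Q) : IsClosed Q := by
  obtain ⟨-, A, b, c, -, -, rfl⟩ := hQ
  exact isClosed_eq (by fun_prop) continuous_const

theorem IsRealQuadric.image (hQ : IsRealQuadric Q)
    (e : EuclideanSpace ℝ (Fin n) ≃ᵃⁱ[ℝ] EuclideanSpace ℝ (Fin n)) : IsRealQuadric (e '' Q) := by
  obtain ⟨hne, T, b, c, hT, hT0, rfl⟩ := isRealQuadric_iff_quadPoly.1 hQ
  obtain ⟨T', b', c', hT', hT'0, hq⟩ := exists_quadPoly_comp_eq hT hT0 b c e.symm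
  refine isRealQuadric_iff_quadPoly.2 ⟨hne.image e, T', b', c', hT', hT'0, ?_⟩
  simp only [← hq]
  exact e.toEquiv.image_eq_preimage_symm _

theorem IsRealQuadric.isConvexQuadric_frontier (hQ : IsRealQuadric Q)
    {p : EuclideanSpace ℝ (Fin n)} (hp : p ∈ Qᶜ) (hV : Convex ℝ (connectedComponentIn Qᶜ p)) :
    IsConvexQuadric (frontier (connectedComponentIn Qᶜ p)) := by
  refine ⟨⟨_, hV, ?_, fun h => ?_, rfl⟩, Q, hQ, p, hp, hV, rfl⟩
  · exact hQ.isClosed.isOpen_compl.connectedComponentIn.affineSpan_eq_top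
      ⟨p, mem_connectedComponentIn hp⟩
  · exact compl_ne_univ.2 hQ.1 (univ_subset_iff.1 (h ▸ connectedComponentIn_subset Qᶜ p))

theorem IsRealQuadric.isConvexQuadric_of_convexOn_of_concaveOn (hQ : IsRealQuadric Q)
    {f g : EuclideanSpace ℝ (Fin n) → ℝ} (hf : ConvexOn ℝ univ f) (hg : ConcaveOn ℝ univ g)
    (hfc : Continuous f) (hgc : Continuous g) {p : EuclideanSpace ℝ (Fin n)} (hp : f p < g p)
    (heq : ∀ x, f x = g x → x ∈ Q) (hlt : ∀ x, f x < g x → x ∉ Q) :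
    IsConvexQuadric {x | f x = g x} := by
  have hconv : Convex ℝ {x | f x < g x} := by simpa using (hf.sub hg).convex_lt 0
  have hfr := frontier_setOf_lt_of_convexOn_of_concaveOn hf hg hfc hgc hp
  have hcomp := connectedComponentIn_compl_eq_setOf_lt hf hg hfc hgc hp heq hlt
  rw [← hfr, ← hcomp]
  exact hQ.isConvexQuadric_frontier (hlt p hp) (hcomp ▸ hconv)

theorem IsConvexQuadric.image (hS : IsConvexQuadric S)
    (e : EuclideanSpace ℝ (Fin n) ≃ᵃⁱ[ℝ] EuclideanSpace ℝ (Fin n)) : IsConvexQuadric (e '' S) := by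
  obtain ⟨-, Q, hQ, p, hp, hV, rfl⟩ := hS
  have hcomp : e '' connectedComponentIn Qᶜ p = connectedComponentIn (e '' Q)ᶜ (e p) :=
    image_connectedComponentIn_compl e.toHomeomorph hp
  have hfr : e '' frontier (connectedComponentIn Qᶜ p) =
      frontier (e '' connectedComponentIn Qᶜ p) := e.toHomeomorph.image_frontier _
  rw [hfr, hcomp]
  refine (hQ.image e).isConvexQuadric_frontier ?_ ?_
  · simpa using hp
  · rw [← hcomp]
    exact hV.affine_image e.toAffineEquiv.toAffineMap

end RealQuadric

section Loci

variable {n : ℕ} {lam : Fin n → ℝ}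

theorem isConvexQuadric_setOf_diagForm_eq (hlam : 0 ≤ lam) (hlam0 : lam ≠ 0) {m : Fin n} {β c : ℝ}
    {p : EuclideanSpace ℝ (Fin n)} (hp : diagForm lam p < β * p m + c)
    (hne : {x | diagForm lam x = β * x m + c}.Nonempty) :
    IsConvexQuadric {x | diagForm lam x = β * x m + c} := by
  have hform (x : EuclideanSpace ℝ (Fin n)) :
      diagForm lam x + -β * x m + -c = 0 ↔ diagForm lam x = β * x m + c := by
    constructor <;> intro h <;> linarith
  have hQ : IsRealQuadric {x | diagForm lam x = β * x m + c} := by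
    simp only [← hform] at hne ⊢
    exact isRealQuadric_diagForm hlam0 hne
  refine hQ.isConvexQuadric_of_convexOn_of_concaveOn (convexOn_diagForm hlam)
    (concaveOn_coord_mul_add m β c) (continuous_diagForm lam) (by fun_prop) hp
    (fun x h => h) fun x h => h.ne

theorem isConvexQuadric_setOf_sqrt_diagForm_eq {d : ℝ} {k : Fin n} (hlam : 0 ≤ lam)
    (hk : lam k = 0) (hd : 0 ≤ d) : IsConvexQuadric {x | √(diagForm lam x + d) = x k} := by
  have hform (x : EuclideanSpace ℝ (Fin n)) :
      diagForm (Function.update lam k (-1)) x + 0 * x k + d = diagForm lam x + d - x k ^ 2 := by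
    rw [diagForm_update, hk]
    ring
  have hQ : IsRealQuadric {x | diagForm lam x + d - x k ^ 2 = 0} := by
    simp only [← hform]
    refine isRealQuadric_diagForm (Function.ne_iff.2 ⟨k, by simp⟩)
      ⟨EuclideanSpace.single k √d, ?_⟩
    simp [diagForm_single, Real.sq_sqrt hd]
  have hconc : ConcaveOn ℝ univ fun x : EuclideanSpace ℝ (Fin n) => x k := by
    simpa using concaveOn_coord_mul_add k 1 0
  have hcont := continuous_diagForm lam
  refine hQ.isConvexQuadric_of_convexOn_of_concaveOn (convexOn_sqrt_diagForm_add hlam hd)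
    hconc (by fun_prop) (by fun_prop) (p := EuclideanSpace.single k (√d + 1)) ?_
    (fun x hx => ?_) fun x hx => ?_
  · simp [diagForm_single, hk]
  · rw [mem_ofPred_eq, ← hx, Real.sq_sqrt (add_nonneg (diagForm_nonneg hlam x) hd), sub_self]
  · exact (sub_neg.2 ((Real.sqrt_lt' ((Real.sqrt_nonneg _).trans_lt hx)).1 hx)).ne

theorem isConvexQuadric_ellipticLocus {a : Fin n → ℝ} {j : Fin n} (ha : ∀ i ≤ j, 0 < a i) :
    IsConvexQuadric (ellipticLocus a j) := by
  have hlam : 0 ≤ (Finset.Iic j : Set (Fin n)).indicator a :=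
    indicator_nonneg fun i hi => (ha i (Finset.mem_Iic.1 hi)).le
  have hj : (Finset.Iic j : Set (Fin n)).indicator a j = a j := by simp
  have hj0 := ha j le_rfl
  have h := isConvexQuadric_setOf_diagForm_eq hlam (Function.ne_iff.2 ⟨j, hj ▸ hj0.ne'⟩)
    (m := j) (β := 0) (c := 1) (p := 0) (by simp [diagForm])
    ⟨EuclideanSpace.single j (√(a j))⁻¹, ?_⟩
  · simpa only [ellipticLocus, diagForm_indicator, zero_mul, zero_add] using h
  · rw [mem_ofPred_eq, diagForm_single, hj, inv_pow, Real.sq_sqrt hj0.le,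
      mul_inv_cancel₀ hj0.ne', zero_mul, zero_add]

variable [NeZero n] {a : Fin n → ℝ} {j : Fin n}

theorem isConvexQuadric_setOf_mul_sq_sub_sum_eq {d : ℝ} (ha : ∀ i ≤ j, 0 < a i) (hd : 0 ≤ d) :
    IsConvexQuadric {ξ : EuclideanSpace ℝ (Fin n) |
      a 0 * ξ 0 ^ 2 - ∑ i ∈ Finset.Ioc 0 j, a i * ξ i ^ 2 = d ∧ 0 ≤ ξ 0} := by
  have ha0 := ha 0 (Fin.zero_le j)
  have hlam : 0 ≤ (Finset.Ioc 0 j : Set (Fin n)).indicator a :=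
    indicator_nonneg fun i hi => (ha i (Finset.mem_Ioc.1 hi).2).le
  simp only [← diagForm_indicator]
  rw [setOf_sub_diagForm_eq_eq_setOf_sqrt 0 ha0 hlam hd]
  exact isConvexQuadric_setOf_sqrt_diagForm_eq (smul_nonneg (inv_pos.2 ha0).le hlam)
    (by simp) (mul_nonneg (inv_pos.2 ha0).le hd)

theorem isConvexQuadric_planeLocus (ha : 0 < a 0) : IsConvexQuadric (planeLocus a) := by
  have h := isConvexQuadric_setOf_sqrt_diagForm_eq (n := n) (k := 0) le_rfl rfl le_rfl
  simpa [planeLocus, diagForm, ha.ne', eq_comm (a := (0 : ℝ))] using h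

theorem isConvexQuadric_parabolicLocus (hj : 0 < j) (ha : ∀ i < j, 0 < a i) :
    IsConvexQuadric (parabolicLocus a j) := by
  have hlam : 0 ≤ (Finset.Iio j : Set (Fin n)).indicator a :=
    indicator_nonneg fun i hi => (ha i (Finset.mem_Iio.1 hi)).le
  have h0 : (Finset.Iio j : Set (Fin n)).indicator a 0 = a 0 := by simp [hj]
  have h := isConvexQuadric_setOf_diagForm_eq hlam
    (Function.ne_iff.2 ⟨0, h0 ▸ (ha 0 hj).ne'⟩) (m := j) (β := 1) (c := 0)
    (p := EuclideanSpace.single j 1) (by simp [diagForm_single]) ⟨0, by simp [diagForm]⟩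
  simpa only [parabolicLocus, diagForm_indicator, one_mul, add_zero] using h

end Loci

section Perm

variable {α : Type*} [Finite α] {I J : Finset α}

theorem exists_perm_forall_mem_iff (h : I.card = J.card) :
    ∃ σ : Equiv.Perm α, ∀ i, i ∈ I ↔ σ i ∈ J := by
  classical
  refine ⟨(Finset.equivOfCardEq h).extendSubtype, fun i => ?_⟩
  by_cases hi : i ∈ I
  · exact iff_of_true hi (Equiv.extendSubtype_mem _ i hi)
  · exact iff_of_false hi (Equiv.extendSubtype_not_mem _ i hi)

theorem exists_perm_apply_eq_forall_mem_iff (h : I.card = J.card) {k l : α} (hk : k ∉ I)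
    (hl : l ∉ J) : ∃ σ : Equiv.Perm α, σ k = l ∧ ∀ i, i ∈ I ↔ σ i ∈ J := by
  classical
  obtain ⟨σ, hσ⟩ := exists_perm_forall_mem_iff h
  have hσk : σ k ∉ J := mt (hσ k).2 hk
  refine ⟨σ.trans (Equiv.swap (σ k) l), by simp, fun i => ?_⟩
  rw [hσ i, Equiv.trans_apply, Equiv.swap_apply_def]
  split_ifs with h1 h2
  · rw [h1]
    exact iff_of_false hσk hl
  · rw [h2]
    exact iff_of_false hl hσk
  · rfl

end Perm

/-- The set `S` is one of the five canonical loci in suitable Cartesian coordinates. -/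
def HasCanonicalCoordinates {n : ℕ} [NeZero n] (S : Set (EuclideanSpace ℝ (Fin n))) : Prop :=
  ∃ e : EuclideanSpace ℝ (Fin n) ≃ᵃⁱ[ℝ] EuclideanSpace ℝ (Fin n), IsCanonicalLocus (e '' S)

namespace HasCanonicalCoordinates

variable {n : ℕ} [NeZero n] {S : Set (EuclideanSpace ℝ (Fin n))} {lam : Fin n → ℝ} {d : ℝ}
  {k : Fin n}

theorem of_preimage (e : EuclideanSpace ℝ (Fin n) ≃ᵃⁱ[ℝ] EuclideanSpace ℝ (Fin n))
    (h : HasCanonicalCoordinates (e ⁻¹' S)) : HasCanonicalCoordinates S := by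
  obtain ⟨f, hf⟩ := h
  have himage : e.symm '' S = e ⁻¹' S := e.symm.toEquiv.image_eq_preimage_symm S
  refine ⟨e.symm.trans f, ?_⟩
  rwa [AffineIsometryEquiv.coe_trans, image_comp, himage]

theorem of_perm (σ : Equiv.Perm (Fin n))
    (h : IsCanonicalLocus {ξ : EuclideanSpace ℝ (Fin n) | WithLp.toLp 2 (fun i => ξ (σ i)) ∈ S}) :
    HasCanonicalCoordinates S := by
  let e := (LinearIsometryEquiv.piLpCongrLeft 2 ℝ ℝ σ.symm).toAffineIsometryEquiv
  have he (ξ : EuclideanSpace ℝ (Fin n)) : e ξ = WithLp.toLp 2 fun i => ξ (σ i) := by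
    ext i
    simp [e, LinearIsometryEquiv.piLpCongrLeft_apply]
  refine of_preimage e ⟨AffineIsometryEquiv.refl ℝ _, ?_⟩
  rw [AffineIsometryEquiv.coe_refl, image_id]
  simpa only [preimage, he] using h

theorem ellipsoid (hlam : 0 ≤ lam) (hlam0 : lam ≠ 0) :
    HasCanonicalCoordinates {x | diagForm lam x = 1} := by
  let I := Finset.univ.filter fun i => lam i ≠ 0
  have hI (i) : i ∈ I ↔ lam i ≠ 0 := by simp [I]
  have hcard : 0 < I.card := Finset.card_pos.2 ((Function.ne_iff.1 hlam0).imp fun i => (hI i).2)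
  have hn : I.card - 1 < n := by
    have := I.card_le_univ
    rw [Fintype.card_fin] at this
    omega
  obtain ⟨σ, hσ⟩ := exists_perm_forall_mem_iff (I := I) (J := Finset.Iic (⟨I.card - 1, hn⟩ : Fin n))
    (by simp; omega)
  have hsupp (i) : i ∈ Finset.Iic (⟨I.card - 1, hn⟩ : Fin n) ↔ (lam ∘ σ.symm) i ≠ 0 := by
    rw [Function.comp_apply, ← hI, hσ, Equiv.apply_symm_apply]
  refine of_perm σ ⟨lam ∘ σ.symm, Or.inl ⟨⟨I.card - 1, hn⟩, fun i hi => ?_, ?_⟩⟩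
  · exact (hlam _).lt_of_ne' ((hsupp i).1 (Finset.mem_Iic.2 hi))
  · simp only [ellipticLocus, mem_ofPred_eq, diagForm_comp_perm, diagForm_eq_sum hsupp]

theorem paraboloid (hlam : 0 ≤ lam) (hlam0 : lam ≠ 0) (hk : lam k = 0) :
    HasCanonicalCoordinates {x | diagForm lam x = x k} := by
  let I := Finset.univ.filter fun i => lam i ≠ 0
  have hI (i) : i ∈ I ↔ lam i ≠ 0 := by simp [I]
  have hcard : 0 < I.card := Finset.card_pos.2 ((Function.ne_iff.1 hlam0).imp fun i => (hI i).2)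
  have hkI : k ∉ I := by simp [I, hk]
  have hn : I.card < n := by simpa using Finset.card_lt_univ_of_notMem hkI
  obtain ⟨σ, hσk, hσ⟩ := exists_perm_apply_eq_forall_mem_iff (I := I)
    (J := Finset.Iio (⟨I.card, hn⟩ : Fin n)) (by simp) hkI (l := ⟨I.card, hn⟩) (by simp)
  have hsupp (i) : i ∈ Finset.Iio (⟨I.card, hn⟩ : Fin n) ↔ (lam ∘ σ.symm) i ≠ 0 := by
    rw [Function.comp_apply, ← hI, hσ, Equiv.apply_symm_apply]
  refine of_perm σ ⟨lam ∘ σ.symm, Or.inr (Or.inr (Or.inr (Or.inr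
    ⟨⟨I.card, hn⟩, ?_, fun i hi => ?_, ?_⟩)))⟩
  · exact Fin.lt_def.2 hcard
  · exact (hlam _).lt_of_ne' ((hsupp i).1 (Finset.mem_Iio.2 hi))
  · simp only [parabolicLocus, mem_ofPred_eq, diagForm_comp_perm, diagForm_eq_sum hsupp, hσk]

theorem hyperplane (k : Fin n) (t : ℝ) :
    HasCanonicalCoordinates {x : EuclideanSpace ℝ (Fin n) | x k = t} := by
  refine of_preimage (AffineIsometryEquiv.constVAdd ℝ _ (EuclideanSpace.single k t))
    (of_perm (Equiv.swap k 0) ⟨1, Or.inr (Or.inr (Or.inl ⟨one_pos, ?_⟩))⟩)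
  ext ξ
  simp [planeLocus]

theorem sheet_of_eq_zero_or_eq_one {α : ℝ} (hα : 0 < α) (hlam : 0 ≤ lam) (hlam0 : lam ≠ 0)
    (hk : lam k = 0) (hd : d = 0 ∨ d = 1) :
    HasCanonicalCoordinates {x | α * x k ^ 2 - diagForm lam x = d ∧ 0 ≤ x k} := by
  let I := Finset.univ.filter fun i => lam i ≠ 0
  have hI (i) : i ∈ I ↔ lam i ≠ 0 := by simp [I]
  have hcard : 0 < I.card := Finset.card_pos.2 ((Function.ne_iff.1 hlam0).imp fun i => (hI i).2)
  have hkI : k ∉ I := by simp [I, hk]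
  have hn : I.card < n := by simpa using Finset.card_lt_univ_of_notMem hkI
  let j : Fin n := ⟨I.card, hn⟩
  have hj : 0 < j := Fin.lt_def.2 hcard
  obtain ⟨σ, hσk, hσ⟩ := exists_perm_apply_eq_forall_mem_iff (I := I)
    (J := Finset.Ioc 0 j) (by simp [j]) hkI (l := 0) (by simp)
  have hsupp (i) : i ∈ Finset.Ioc 0 j ↔ (lam ∘ σ.symm) i ≠ 0 := by
    rw [Function.comp_apply, ← hI, hσ, Equiv.apply_symm_apply]
  let a := Function.update (lam ∘ σ.symm) 0 α
  have ha0 : a 0 = α := Function.update_self ..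
  have ha {i} (hi : i ≠ 0) : a i = (lam ∘ σ.symm) i := Function.update_of_ne hi ..
  have hpos (i) (hi : i ≤ j) : 0 < a i := by
    rcases eq_or_ne i 0 with rfl | hi0
    · rwa [ha0]
    · rw [ha hi0]
      exact (hlam _).lt_of_ne' ((hsupp i).1 (Finset.mem_Ioc.2 ⟨Fin.pos_iff_ne_zero.2 hi0, hi⟩))
  have hsum (ξ : EuclideanSpace ℝ (Fin n)) : diagForm lam (WithLp.toLp 2 fun i => ξ (σ i)) =
      ∑ i ∈ Finset.Ioc 0 j, a i * ξ i ^ 2 := by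
    rw [diagForm_comp_perm, diagForm_eq_sum hsupp]
    exact Finset.sum_congr rfl fun i hi => by rw [ha (Finset.mem_Ioc.1 hi).1.ne']
  refine of_perm σ ⟨a, ?_⟩
  simp only [mem_ofPred_eq, hsum, hσk, ← ha0]
  rcases hd with rfl | rfl
  · exact Or.inr (Or.inr (Or.inr (Or.inl ⟨j, hj, hpos, rfl⟩)))
  · exact Or.inr (Or.inl ⟨j, hj, hpos, rfl⟩)

theorem sheet (hlam : 0 ≤ lam) (hk : lam k = 0) (hd : 0 ≤ d) :
    HasCanonicalCoordinates {x | √(diagForm lam x + d) = x k} := by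
  rcases eq_or_ne lam 0 with rfl | hlam0
  · simpa [diagForm, eq_comm] using hyperplane k √d
  rcases hd.eq_or_lt with rfl | hd
  · have h := sheet_of_eq_zero_or_eq_one one_pos hlam hlam0 hk (Or.inl rfl)
    rw [setOf_sub_diagForm_eq_eq_setOf_sqrt k one_pos hlam le_rfl] at h
    simpa only [inv_one, one_smul, mul_zero] using h
  · have hinv : 0 < d⁻¹ := inv_pos.2 hd
    have hlam' : 0 ≤ d⁻¹ • lam := smul_nonneg hinv.le hlam
    have h := sheet_of_eq_zero_or_eq_one (k := k) hinv hlam' (smul_ne_zero hinv.ne' hlam0)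
      (by simp [hk]) (Or.inr rfl)
    rw [setOf_sub_diagForm_eq_eq_setOf_sqrt k hinv hlam' zero_le_one] at h
    simpa only [inv_inv, smul_inv_smul₀ hd.ne', mul_one] using h

theorem sheet_neg (hlam : 0 ≤ lam) (hk : lam k = 0) (hd : 0 ≤ d) :
    HasCanonicalCoordinates {x | √(diagForm lam x + d) = -x k} := by
  refine of_preimage (LinearIsometryEquiv.neg ℝ).toAffineIsometryEquiv ?_
  simpa [diagForm] using sheet hlam hk hd

theorem of_diagForm_eq {m : Fin n} {β c : ℝ} {p : EuclideanSpace ℝ (Fin n)} (hlam : 0 ≤ lam)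
    (hlam0 : lam ≠ 0) (hβ : 0 ≤ β)
    (hm : β ≠ 0 → lam m = 0 ∧ c = 0) (hp : diagForm lam p < β * p m + c) :
    HasCanonicalCoordinates {x | diagForm lam x = β * x m + c} := by
  rcases hβ.eq_or_lt with rfl | hβ
  · have hc : 0 < c := by linarith [diagForm_nonneg hlam p]
    have h := ellipsoid (smul_nonneg (inv_pos.2 hc).le hlam)
      (smul_ne_zero (inv_pos.2 hc).ne' hlam0)
    simpa only [diagForm_smul, inv_mul_eq_one₀ hc.ne', eq_comm (a := c), zero_mul, zero_add] using h
  · obtain ⟨hm0, rfl⟩ := hm hβ.ne'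
    have h := paraboloid (k := m) (smul_nonneg (inv_pos.2 hβ).le hlam)
      (smul_ne_zero (inv_pos.2 hβ).ne' hlam0) (by rw [Pi.smul_apply, hm0, smul_zero])
    simpa only [diagForm_smul, inv_mul_eq_iff_eq_mul₀ hβ.ne', add_zero] using h

end HasCanonicalCoordinates

section NormalForm

variable {ι : Type*} [Fintype ι] {lam : ι → ℝ} {m : ι} {β c : ℝ} {p : EuclideanSpace ℝ ι}

theorem frontier_connectedComponentIn_of_nonpos (hlam : lam ≤ 0)
    (hp : 0 < diagForm lam p + β * p m + c) :
    frontier (connectedComponentIn {x | diagForm lam x + β * x m + c = 0}ᶜ p) =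
      {x | diagForm (-lam) x = β * x m + c} := by
  have hf := convexOn_diagForm (neg_nonneg.2 hlam)
  have hg := concaveOn_coord_mul_add m β c
  have hcont := continuous_diagForm (-lam)
  have hp' : diagForm (-lam) p < β * p m + c := by
    rw [diagForm_neg]
    linarith
  rw [connectedComponentIn_compl_eq_setOf_lt hf hg hcont (by fun_prop) hp',
    frontier_setOf_lt_of_convexOn_of_concaveOn hf hg hcont (by fun_prop) hp']
  · intro x hx
    rw [diagForm_neg] at hx
    rw [mem_ofPred_eq]
    linarith
  · intro x hx hxQ
    rw [diagForm_neg] at hx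
    rw [mem_ofPred_eq] at hxQ
    linarith

theorem frontier_setOf_sqrt_diagForm_add_lt {ℓ : EuclideanSpace ℝ ι →L[ℝ] ℝ}
    (hlam : 0 ≤ lam) (hc : 0 ≤ c) (hp : √(diagForm lam p + c) < ℓ p) :
    frontier {x | √(diagForm lam x + c) < ℓ x} = {x | √(diagForm lam x + c) = ℓ x} := by
  have hcont := continuous_diagForm lam
  exact frontier_setOf_lt_of_convexOn_of_concaveOn (convexOn_sqrt_diagForm_add hlam hc)
    (ℓ.toLinearMap.concaveOn convex_univ) (by fun_prop) ℓ.continuous hp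

theorem diagForm_add_coord_eq_mul_sq_sub [DecidableEq ι] {k : ι} (hk : lam k ≠ 0) (m : ι) (β c : ℝ)
    (x : EuclideanSpace ℝ ι) : diagForm lam x + β * x m + c =
      lam k * (x k ^ 2 - (diagForm (Function.update (-(lam k)⁻¹ • lam) k 0) x +
        -(β / lam k) * x m + -(c / lam k))) := by
  rw [diagForm_eq_mul_sq_sub hk]
  field

theorem diagForm_add_coord_add_smul_single [DecidableEq ι] {k : ι} (hk : lam k = 0)
    (hm : β ≠ 0 → m ≠ k) (x : EuclideanSpace ℝ ι) (t : ℝ) :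
    diagForm lam (x + t • EuclideanSpace.single k 1) +
      β * (x + t • EuclideanSpace.single k 1 : EuclideanSpace ℝ ι) m =
        diagForm lam x + β * x m := by
  by_cases hβ : β = 0
  · simp [hβ, diagForm_add_smul_single hk]
  · simp [hm hβ, diagForm_add_smul_single hk]

theorem exists_frontier_connectedComponentIn_eq_sheet {k : ι} (hk : 0 < lam k)
    (hm : β ≠ 0 → lam m = 0) (hQ : {x | diagForm lam x + β * x m + c = 0}.Nonempty)
    (hp : 0 < diagForm lam p + β * p m + c)
    (hV : Convex ℝ (connectedComponentIn {x | diagForm lam x + β * x m + c = 0}ᶜ p)) :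
    ∃ ν d, 0 ≤ ν ∧ ν k = 0 ∧ 0 ≤ d ∧
      (frontier (connectedComponentIn {x | diagForm lam x + β * x m + c = 0}ᶜ p) =
          {x | √(diagForm ν x + d) = x k} ∨
        frontier (connectedComponentIn {x | diagForm lam x + β * x m + c = 0}ᶜ p) =
          {x | √(diagForm ν x + d) = -x k}) := by
  classical
  let ν := Function.update (-(lam k)⁻¹ • lam) k 0
  let r := fun x : EuclideanSpace ℝ ι => diagForm ν x + -(β / lam k) * x m + -(c / lam k)
  have hνk : ν k = 0 := Function.update_self ..
  have hβm (hβ : -(β / lam k) ≠ 0) : lam m = 0 ∧ m ≠ k := by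
    have hm0 : lam m = 0 := hm (left_ne_zero_of_mul (neg_ne_zero.1 hβ))
    exact ⟨hm0, fun hmk => hk.ne' (hmk ▸ hm0)⟩
  have hq := diagForm_add_coord_eq_mul_sq_sub hk.ne' m β c
  have hQr : {x | diagForm lam x + β * x m + c = 0} = {x | EuclideanSpace.proj k x ^ 2 = r x} := by
    ext x
    rw [mem_ofPred_eq, hq, mul_eq_zero_iff_left hk.ne', sub_eq_zero, mem_ofPred_eq,
      EuclideanSpace.coe_proj]
  have hr : Continuous r := ((continuous_diagForm ν).add (by fun_prop)).add continuous_const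
  have hrk (x) (t : ℝ) : r (x + t • EuclideanSpace.single k 1) = r x :=
    congrArg (· + _) (diagForm_add_coord_add_smul_single hνk (fun h => (hβm h).2) x t)
  have hrp : r p < EuclideanSpace.proj (𝕜 := ℝ) k p ^ 2 := by
    rw [hq] at hp
    exact sub_pos.1 ((pos_iff_pos_of_mul_pos hp).1 hk)
  rw [hQr] at hQ hV ⊢
  obtain ⟨hr0, hV'⟩ := connectedComponentIn_eq_sheet hr (by simp) hrk hQ hV hrp
  obtain ⟨hν, hβ0, hd⟩ := nonneg_of_forall_diagForm_add_nonneg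
    (fun hβ => by simp [ν, hβm hβ]) hr0
  have hrd : r = fun x => diagForm ν x + -(c / lam k) := by
    funext x
    simp [r, hβ0]
  have hpV := mem_connectedComponentIn (F := {x | EuclideanSpace.proj k x ^ 2 = r x}ᶜ) hrp.ne'
  simp only [hrd] at hV' hpV ⊢
  refine ⟨ν, -(c / lam k), hν, hνk, hd, hV'.imp (fun h => ?_) fun h => ?_⟩
  · rw [h] at hpV ⊢
    exact frontier_setOf_sqrt_diagForm_add_lt hν hd hpV
  · rw [h] at hpV ⊢
    exact frontier_setOf_sqrt_diagForm_add_lt (ℓ := -EuclideanSpace.proj k) hν hd hpV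

end NormalForm

section Characterization

variable {n : ℕ} [NeZero n] {S : Set (EuclideanSpace ℝ (Fin n))}

theorem hasCanonicalCoordinates_frontier_connectedComponentIn {lam : Fin n → ℝ} {m : Fin n}
    {β c : ℝ} {p : EuclideanSpace ℝ (Fin n)} (hlam0 : lam ≠ 0) (hβ : 0 ≤ β)
    (hm : β ≠ 0 → lam m = 0 ∧ c = 0)
    (hQ : {x | diagForm lam x + β * x m + c = 0}.Nonempty)
    (hp : 0 < diagForm lam p + β * p m + c)
    (hV : Convex ℝ (connectedComponentIn {x | diagForm lam x + β * x m + c = 0}ᶜ p)) :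
    HasCanonicalCoordinates
      (frontier (connectedComponentIn {x | diagForm lam x + β * x m + c = 0}ᶜ p)) := by
  by_cases hlam : lam ≤ 0
  · rw [frontier_connectedComponentIn_of_nonpos hlam hp]
    refine .of_diagForm_eq (p := p) (neg_nonneg.2 hlam) (neg_ne_zero.2 hlam0) hβ
      (fun h => by simpa using hm h) ?_
    rw [diagForm_neg]
    linarith
  · obtain ⟨k, hk⟩ : ∃ k, 0 < lam k := by simpa [Pi.le_def] using hlam
    obtain ⟨ν, d, hν, hνk, hd, h | h⟩ := exists_frontier_connectedComponentIn_eq_sheet hk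
      (fun h => (hm h).1) hQ hp hV
    · exact h ▸ .sheet hν hνk hd
    · exact h ▸ .sheet_neg hν hνk hd

theorem IsConvexQuadric.hasCanonicalCoordinates (hS : IsConvexQuadric S) :
    HasCanonicalCoordinates S := by
  obtain ⟨-, Q, hQ, p, hp, hV, rfl⟩ := hS
  have hne := hQ.1
  obtain ⟨T, b, c, hT, hT0, hpos, rfl⟩ := hQ.exists_quadPoly_pos hp
  obtain ⟨e, lam, m, β, c₀, hlam0, hβ, hm, hq⟩ :=
    exists_quadPoly_eq_diagForm finrank_euclideanSpace_fin hT hT0 b c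
  have hQ : e '' {x | quadPoly T b c x = 0} = {y | diagForm lam y + β * y m + c₀ = 0} := by
    simp only [hq]
    exact e.surjective.image_preimage {y | diagForm lam y + β * y m + c₀ = 0}
  have hcomp := image_connectedComponentIn_compl e.toHomeomorph hp
  rw [AffineIsometryEquiv.coe_toHomeomorph, hQ] at hcomp
  obtain ⟨f, hf⟩ := hasCanonicalCoordinates_frontier_connectedComponentIn hlam0 hβ hm
    (hQ ▸ hne.image e) (hq p ▸ hpos) (hcomp ▸ hV.affine_image e.toAffineEquiv.toAffineMap)
  refine ⟨e.trans f, ?_⟩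
  rwa [← hcomp, ← e.coe_toHomeomorph, ← e.toHomeomorph.image_frontier, ← image_comp] at hf

theorem IsCanonicalLocus.isConvexQuadric (hS : IsCanonicalLocus S) : IsConvexQuadric S := by
  obtain ⟨a, ⟨j, ha, rfl⟩ | ⟨j, -, ha, rfl⟩ | ⟨ha, rfl⟩ | ⟨j, -, ha, rfl⟩ | ⟨j, hj, ha, rfl⟩⟩ := hS
  · exact isConvexQuadric_ellipticLocus ha
  · exact isConvexQuadric_setOf_mul_sq_sub_sum_eq ha zero_le_one
  · exact isConvexQuadric_planeLocus ha
  · exact isConvexQuadric_setOf_mul_sq_sub_sum_eq ha le_rfl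
  · exact isConvexQuadric_parabolicLocus hj ha

end Characterization

theorem corollary1_general {n : ℕ} [NeZero n] (S : Set (EuclideanSpace ℝ (Fin n))) :
    IsConvexQuadric S ↔
      ∃ e : EuclideanSpace ℝ (Fin n) ≃ᵃⁱ[ℝ] EuclideanSpace ℝ (Fin n),
        IsCanonicalLocus (e '' S) := by
  refine ⟨IsConvexQuadric.hasCanonicalCoordinates, fun ⟨e, he⟩ => ?_⟩
  simpa [← image_comp] using he.isConvexQuadric.image e.symm

/-- A system of Cartesian coordinates is an affine isometry `e` of `ℝⁿ`, which sends a point to its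
coordinate vector. -/
theorem corollary1 {n : ℕ} [NeZero n] (hn : 2 ≤ n) (S : Set (EuclideanSpace ℝ (Fin n)))
    (hS : IsConvexSurface S) :
    IsConvexQuadric S ↔
      ∃ e : EuclideanSpace ℝ (Fin n) ≃ᵃⁱ[ℝ] EuclideanSpace ℝ (Fin n),
        IsCanonicalLocus (e '' S) :=
  corollary1_general S
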